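/- Let $\mathbb K=\mathbb R$ or $\mathbb C$; manifolds are Hausdorff, without boundary, and smooth if $\mathbb K=\mathbb R$, holomorphic if $\mathbb K=\mathbb C$, with dimensions taken over $\mathbb K$; "smooth" below means holomorphic if $\mathbb K=\mathbb C$. A Poisson structure on a manifold $M$ is a smooth bivector field $\pi\in\Gamma(\wedge^2TM)$ whose bracket $\{f,g\}=\pi(df,dg)$ on local smooth functions satisfies the Jacobi identity; it is symplectic if $\pi^\#_m:T_m^*M\to T_mM$, $\beta(\pi^\#_m\alpha)=\pi_m(\alpha,\beta)$, is invertible for every $m\in M$. The singular locus of $\pi$ is the set of points $m\in M$ at which the rank of $\pi^\#_m$ is not maximal, i.e. is smaller than the rank of $\pi^\#_{m'}$ for some $m'\in M$. A symplectic resolution of a Poisson manifold $(M,\pi)$ is a triple $(\Sigma,\Pi,\varphi)$, where $(\Sigma,\Pi)$ is a symplectic Poisson manifold with $\dim\Sigma=\dim M$ and $\varphi:\Sigma\to M$ is a surjective Poisson morphism, i.e. a surjective smooth map with $\{f\circ\varphi,g\circ\varphi\}_\Sigma=\{f,g\}_M\circ\varphi$ for all local smooth functions $f,g$ on $M$. Let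 $(M,\pi)$ be a Poisson manifold of dimension $n\ge 4$ whose singular locus contains a non-empty embedded submanifold $P\subset M$ of codimension $1$. If $(M,\pi)$ admits a symplectic resolution $(\Sigma,\Pi,\varphi)$ with $\Sigma$ second countable, then $\pi$ does not vanish at all points of $P$: there is $p\in P$ with $\pi_p\ne 0$. -/

import Mathlib

open scoped Manifold ContDiff

noncomputable section

/-- The differential of a scalar function at `x`, as a cotangent vector in `T*ₓM`. -/
def cotangentDiff {𝕜 : Type*} [RCLike 𝕜] (E : Type*) [NormedAddCommGroup E] [NormedSpace 𝕜 E]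
    {M : Type*} [TopologicalSpace M] [ChartedSpace E M] (f : M → 𝕜) (x : M) :
    TangentSpace 𝓘(𝕜, E) x →L[𝕜] 𝕜 :=
  mfderiv 𝓘(𝕜, E) 𝓘(𝕜, 𝕜) f x

/-- The bracket `{f, g} = π(df, dg) = dg (π♯ df)` associated with a field of linear maps
`π♯ₓ : T*ₓM → TₓM`. -/
def sharpBracket {𝕜 : Type*} [RCLike 𝕜] {E : Type*} [NormedAddCommGroup E] [NormedSpace 𝕜 E]
    {M : Type*} [TopologicalSpace M] [ChartedSpace E M]
    (sharp : ∀ x : M, (TangentSpace 𝓘(𝕜, E) x →L[𝕜] 𝕜) →L[𝕜] TangentSpace 𝓘(𝕜, E) x)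
    (f g : M → 𝕜) (x : M) : 𝕜 :=
  cotangentDiff E g x (sharp x (cotangentDiff E f x))

/-- A Poisson structure on a manifold `M` without boundary modelled on the finite-dimensional
space `E`: smooth if `𝕜 = ℝ`, holomorphic if `𝕜 = ℂ` (where `C^∞` over `ℂ` means holomorphic).
The bivector field `π`, a section of `⋀²TM`, is given by the skew-symmetric maps
`π♯ₓ : T*ₓM → TₓM`, `β (π♯ₓ α) = πₓ(α, β)`. It is smooth, i.e. brackets of smooth local functions
are smooth, and its bracket of local functions satisfies the Jacobi identity. -/
structure PoissonStructure (𝕜 : Type*) [RCLike 𝕜] (E : Type*) [NormedAddCommGroup E]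
    [NormedSpace 𝕜 E] (M : Type*) [TopologicalSpace M] [ChartedSpace E M] where
  sharp : ∀ x : M, (TangentSpace 𝓘(𝕜, E) x →L[𝕜] 𝕜) →L[𝕜] TangentSpace 𝓘(𝕜, E) x
  skew : ∀ (x : M) (α : TangentSpace 𝓘(𝕜, E) x →L[𝕜] 𝕜), α (sharp x α) = 0
  smooth : ∀ (U : Set M), IsOpen U → ∀ f g : M → 𝕜,
    ContMDiffOn 𝓘(𝕜, E) 𝓘(𝕜, 𝕜) ∞ f U → ContMDiffOn 𝓘(𝕜, E) 𝓘(𝕜, 𝕜) ∞ g U →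
    ContMDiffOn 𝓘(𝕜, E) 𝓘(𝕜, 𝕜) ∞ (sharpBracket sharp f g) U
  jacobi : ∀ (U : Set M), IsOpen U → ∀ f g h : M → 𝕜,
    ContMDiffOn 𝓘(𝕜, E) 𝓘(𝕜, 𝕜) ∞ f U → ContMDiffOn 𝓘(𝕜, E) 𝓘(𝕜, 𝕜) ∞ g U →
    ContMDiffOn 𝓘(𝕜, E) 𝓘(𝕜, 𝕜) ∞ h U → ∀ x ∈ U,
    sharpBracket sharp f (sharpBracket sharp g h) x
      + sharpBracket sharp g (sharpBracket sharp h f) x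
      + sharpBracket sharp h (sharpBracket sharp f g) x = 0

namespace PoissonStructure

variable {𝕜 : Type*} [RCLike 𝕜] {E : Type*} [NormedAddCommGroup E] [NormedSpace 𝕜 E]
  {M : Type*} [TopologicalSpace M] [ChartedSpace E M]
  {F : Type*} [NormedAddCommGroup F] [NormedSpace 𝕜 F]
  {S : Type*} [TopologicalSpace S] [ChartedSpace F S]

/-- The Poisson bracket of two functions. -/
def bracket (π : PoissonStructure 𝕜 E M) (f g : M → 𝕜) : M → 𝕜 :=
  sharpBracket π.sharp f g

/-- The rank of the bivector at a point. -/
def rank (π : PoissonStructure 𝕜 E M) (x : M) : ℕ :=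
  Module.finrank 𝕜 (LinearMap.range (π.sharp x).toLinearMap)

/-- The singular locus: the points where `π♯` is not of maximal rank. -/
def singularLocus (π : PoissonStructure 𝕜 E M) : Set M :=
  {x | ¬ ∀ y, π.rank y ≤ π.rank x}

/-- A symplectic Poisson structure: the bivector is invertible at every point. -/
def IsSymplectic (π : PoissonStructure 𝕜 E M) : Prop :=
  ∀ x, Function.Bijective (π.sharp x)

/-- A smooth (holomorphic) map `φ : S → M` with `{φ*f, φ*g}_S = φ*{f, g}_M` for all local smooth
(holomorphic) functions `f`, `g` on `M`. -/
structure IsPoissonMorphism (πS : PoissonStructure 𝕜 F S) (πM : PoissonStructure 𝕜 E M)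
    (φ : S → M) : Prop where
  contMDiff : ContMDiff 𝓘(𝕜, F) 𝓘(𝕜, E) ∞ φ
  map_bracket : ∀ (U : Set M), IsOpen U → ∀ f g : M → 𝕜,
    ContMDiffOn 𝓘(𝕜, E) 𝓘(𝕜, 𝕜) ∞ f U → ContMDiffOn 𝓘(𝕜, E) 𝓘(𝕜, 𝕜) ∞ g U →
    ∀ s ∈ φ ⁻¹' U, πS.bracket (f ∘ φ) (g ∘ φ) s = πM.bracket f g (φ s)

/-- `(S, πS, φ)` is a symplectic resolution of `(M, πM)`: a symplectic manifold of the same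
dimension together with a surjective Poisson morphism. -/
structure IsSymplecticResolution (πS : PoissonStructure 𝕜 F S) (πM : PoissonStructure 𝕜 E M)
    (φ : S → M) : Prop where
  finrank_eq : Module.finrank 𝕜 F = Module.finrank 𝕜 E
  symplectic : πS.IsSymplectic
  morphism : IsPoissonMorphism πS πM φ
  surjective : Function.Surjective φ

end PoissonStructure

/-- An (embedded) submanifold of codimension `k` of a manifold `M` modelled on `E`: a subset that,
in suitable charts around each of its points, is a linear subspace of codimension `k`. -/
def IsSubmanifoldOfCodim (𝕜 : Type*) [RCLike 𝕜] (E : Type*) [NormedAddCommGroup E]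
    [NormedSpace 𝕜 E] {M : Type*} [TopologicalSpace M] [ChartedSpace E M]
    (k : ℕ) (P : Set M) : Prop :=
  ∀ p ∈ P, ∃ e ∈ IsManifold.maximalAtlas 𝓘(𝕜, E) ∞ M, p ∈ e.source ∧
    ∃ W : Submodule 𝕜 E, Module.finrank 𝕜 W + k = Module.finrank 𝕜 E ∧
      ∀ x ∈ e.source, x ∈ P ↔ e x ∈ W

end

open MeasureTheory Measure Set Filter Topology Module
open scoped NNReal ENNReal

/-! ### Taylor bounds at critical points -/

section Calculus

variable {X : Type*} [NormedAddCommGroup X] [NormedSpace ℝ X]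
  {Y : Type*} [NormedAddCommGroup Y] [NormedSpace ℝ Y]

/-! Suppose π vanishes on P. Over P, functions pulled back from M have zero brackets on Σ, so the
image of the dual of Dφ is isotropic for the symplectic Π and φ has rank at most n/2
(`two_mul_finrank_range_mfderiv_le`). Flatten P to a hyperplane W by a chart and project to W: this
map has rank at most n/2 < n - 1 along the preimage of P. A Sard theorem for low rank makes the
image null in W, while surjectivity of φ makes it contain an open set.

The Sard theorem (`hausdorffMeasure_image_null_of_finrank_range_le`) straightens the map to (u, v) ↦
(u, G(u, v)), where low rank means that G is critical in v. By Fubini it remains to treat points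
with Dg = 0, for g into dimension d from dimension at most 2d. Where D²g = 0, g is Hölder of
exponent 3 and the image is null. Elsewhere the exponent is 2, and the critical set itself is null
because Dg vanishes on it and D²g does not. -/

/-- Integrating a bound `‖Dh(z)‖ ≤ C ‖z - x‖ ^ m` on a convex set raises the exponent by one. -/
theorem Convex.norm_sub_le_of_norm_fderiv_le_pow {h : X → Y} {B : Set X} (hB : Convex ℝ B)
    {C : ℝ} {m : ℕ} {x y : X} (hx : x ∈ B) (hy : y ∈ B) (hC : 0 ≤ C)
    (hd : ∀ z ∈ B, DifferentiableAt ℝ h z)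
    (hb : ∀ z ∈ B, ‖fderiv ℝ h z‖ ≤ C * ‖z - x‖ ^ m) :
    ‖h y - h x‖ ≤ C * ‖y - x‖ ^ (m + 1) := by
  have key := (hB.inter (convex_closedBall x ‖y - x‖)).norm_image_sub_le_of_norm_hasFDerivWithin_le
    (f := h) (f' := fderiv ℝ h) (C := C * ‖y - x‖ ^ m) (x := x) (y := y)
    (fun z hz ↦ (hd z hz.1).hasFDerivAt.hasFDerivWithinAt)
    (fun z hz ↦ (hb z hz.1).trans (by
      have : ‖z - x‖ ≤ ‖y - x‖ := by simpa [dist_eq_norm] using hz.2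
      gcongr))
    ⟨hx, by simp⟩ ⟨hy, by simp [dist_eq_norm]⟩
  rwa [pow_succ, ← mul_assoc]

theorem ContDiffAt.exists_eventually_norm_fderiv_le {h : X → Y} {a : X} (hh : ContDiffAt ℝ 1 h a) :
    ∃ C : ℝ, 0 ≤ C ∧ ∀ᶠ z in 𝓝 a, DifferentiableAt ℝ h z ∧ ‖fderiv ℝ h z‖ ≤ C := by
  have hc : ContinuousAt (fun z ↦ ‖fderiv ℝ h z‖) a :=
    (hh.fderiv_right (m := 0) (by norm_num)).continuousAt.norm
  refine ⟨‖fderiv ℝ h a‖ + 1, by positivity, ?_⟩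
  filter_upwards [hh.eventually (by simp), hc.eventually_le_const (lt_add_one _)] with z h₁ h₂
  exact ⟨h₁.differentiableAt (by simp), h₂⟩

/-- `C` bounds D²g near `a`, independently of the critical point `x`; hence `g` is Hölder of
exponent 2 on the critical set near `a`. -/
theorem ContDiffAt.exists_ball_norm_sub_le_sq {g : X → Y} {a : X} (hg : ContDiffAt ℝ 2 g a) :
    ∃ C : ℝ, 0 ≤ C ∧ ∃ δ > 0, ∀ x ∈ Metric.ball a δ, fderiv ℝ g x = 0 →
      ∀ y ∈ Metric.ball a δ, ‖g y - g x‖ ≤ C * ‖y - x‖ ^ 2 := by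
  obtain ⟨C, hC, hb⟩ := (hg.fderiv_right (m := 1) (by norm_num)).exists_eventually_norm_fderiv_le
  have hd : ∀ᶠ z in 𝓝 a, DifferentiableAt ℝ g z :=
    (hg.eventually (by simp)).mono fun z hz ↦ hz.differentiableAt (by simp)
  obtain ⟨δ, hδ, hball⟩ := Metric.eventually_nhds_iff_ball.1 (hb.and hd)
  refine ⟨C, hC, δ, hδ, fun x hx h₁ y hy ↦ ?_⟩
  have hB := convex_ball a δ
  refine hB.norm_sub_le_of_norm_fderiv_le_pow (m := 1) hx hy hC (fun z hz ↦ (hball z hz).2)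
    fun z hz ↦ ?_
  simpa [h₁] using hB.norm_sub_le_of_norm_fderiv_le_pow (h := fderiv ℝ g) (m := 0) hx hz hC
    (fun w hw ↦ (hball w hw).1.1) (fun w hw ↦ by simpa using (hball w hw).1.2)

theorem ContDiffAt.exists_ball_norm_sub_le_cube {g : X → Y} {a : X} (hg : ContDiffAt ℝ 3 g a) :
    ∃ C : ℝ, 0 ≤ C ∧ ∃ δ > 0, ∀ x ∈ Metric.ball a δ, fderiv ℝ g x = 0 →
      fderiv ℝ (fderiv ℝ g) x = 0 →
      ∀ y ∈ Metric.ball a δ, ‖g y - g x‖ ≤ C * ‖y - x‖ ^ 3 := by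
  have hg' : ContDiffAt ℝ 2 (fderiv ℝ g) a := hg.fderiv_right (by norm_num)
  obtain ⟨C, hC, hb⟩ := (hg'.fderiv_right (m := 1) (by norm_num)).exists_eventually_norm_fderiv_le
  have hd : ∀ᶠ z in 𝓝 a, DifferentiableAt ℝ g z :=
    (hg.eventually (by simp)).mono fun z hz ↦ hz.differentiableAt (by simp)
  have hd' : ∀ᶠ z in 𝓝 a, DifferentiableAt ℝ (fderiv ℝ g) z :=
    (hg'.eventually (by simp)).mono fun z hz ↦ hz.differentiableAt (by simp)
  obtain ⟨δ, hδ, hball⟩ := Metric.eventually_nhds_iff_ball.1 (hb.and (hd.and hd'))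
  refine ⟨C, hC, δ, hδ, fun x hx h₁ h₂ y hy ↦ ?_⟩
  have hB := convex_ball a δ
  refine hB.norm_sub_le_of_norm_fderiv_le_pow (m := 2) hx hy hC (fun z hz ↦ (hball z hz).2.1)
    fun z hz ↦ ?_
  have h := hB.norm_sub_le_of_norm_fderiv_le_pow (h := fderiv ℝ g) (m := 1) hx hz hC
    (fun w hw ↦ (hball w hw).2.2) (fun w hw ↦ by
      simpa [h₂] using hB.norm_sub_le_of_norm_fderiv_le_pow (h := fderiv ℝ (fderiv ℝ g)) (m := 0)
        hx hw hC (fun v hv ↦ (hball v hv).1.1) (fun v hv ↦ by simpa using (hball v hv).1.2))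
  simpa [h₁] using h

end Calculus

/-! ### Null images of critical sets -/

section Null

/-- Lindelöf: countably many of the neighbourhoods cover `K`. Second countability of Σ enters the
main theorem here. -/
theorem measure_image_null_of_locally_null {X : Type*} [TopologicalSpace X]
    [SecondCountableTopology X] {Y : Type*} [MeasurableSpace Y] {ν : Measure Y} {f : X → Y}
    {K : Set X} (h : ∀ a ∈ K, ∃ V ∈ 𝓝 a, ν (f '' (K ∩ V)) = 0) : ν (f '' K) = 0 := by
  choose! V hV hnull using h
  obtain ⟨t, htK, htc, hcov⟩ := TopologicalSpace.countable_cover_nhdsWithin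
    (f := V) (s := K) fun x hx ↦ mem_nhdsWithin_of_mem_nhds (hV x hx)
  refine measure_mono_null (t := ⋃ a ∈ t, f '' (K ∩ V a)) ?_
    ((measure_biUnion_null_iff htc).2 fun a ha ↦ hnull a (htK ha))
  rintro _ ⟨x, hx, rfl⟩
  obtain ⟨a, ha, hxa⟩ := mem_iUnion₂.1 (hcov hx)
  exact mem_iUnion₂.2 ⟨a, ha, x, ⟨hx, hxa⟩, rfl⟩

theorem hausdorffMeasure_eq_zero_of_finrank_lt {X : Type*} [NormedAddCommGroup X]
    [NormedSpace ℝ X] [FiniteDimensional ℝ X] [MeasurableSpace X] [BorelSpace X] {d : ℕ} (h : finrank ℝ X < d) (s : Set X) :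
    μH[(d : ℝ)] s = 0 := by
  have : dimH s < ((d : ℝ≥0) : ℝ≥0∞) := by
    refine (dimH_mono (subset_univ s)).trans_lt ?_
    rw [Real.dimH_univ_eq_finrank]
    exact_mod_cast h
  simpa using hausdorffMeasure_of_dimH_lt this

theorem hausdorffMeasure_image_null_of_norm_sub_le_pow {X : Type*} [NormedAddCommGroup X]
    [MeasurableSpace X] [BorelSpace X] {Y : Type*} [NormedAddCommGroup Y] [MeasurableSpace Y]
    [BorelSpace Y] {g : X → Y} {s : Set X} {C : ℝ}
    (hC : 0 ≤ C) {m : ℕ} (hm : 0 < m) (h : ∀ x ∈ s, ∀ y ∈ s, ‖g y - g x‖ ≤ C * ‖y - x‖ ^ m)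
    {d : ℕ} (hs : μH[((m * d : ℕ) : ℝ)] s = 0) : μH[(d : ℝ)] (g '' s) = 0 := by
  have hh : HolderOnWith ⟨C, hC⟩ m g s := by
    intro x hx y hy
    have := h y hy x hx
    rw [edist_dist, edist_dist, dist_eq_norm, dist_eq_norm, NNReal.coe_natCast,
      ENNReal.rpow_natCast, ← ENNReal.ofReal_pow (norm_nonneg _)]
    refine (ENNReal.ofReal_le_ofReal this).trans_eq ?_
    rw [ENNReal.ofReal_mul hC, ENNReal.ofReal_eq_coe_nnreal hC]
    rfl
  have := hh.hausdorffMeasure_image_le (by exact_mod_cast hm) (d := d) (by positivity)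
  push_cast at hs this
  rw [hs, mul_zero] at this
  exact le_antisymm this zero_le

/-- A set on which a function vanishes while its derivative does not is Lebesgue null. -/
theorem measure_null_of_eq_zero_of_fderiv_ne_zero {X : Type*} [NormedAddCommGroup X]
    [NormedSpace ℝ X] [FiniteDimensional ℝ X] [MeasurableSpace X] [BorelSpace X]
    {Y : Type*} [NormedAddCommGroup Y] [NormedSpace ℝ Y] (μ : Measure X) [μ.IsAddHaarMeasure]
    {h : X → Y} {s : Set X} (hs : MeasurableSet s) (hz : ∀ x ∈ s, h x = 0)
    (ℓ : Y →L[ℝ] ℝ) (hd : ∀ x ∈ s, DifferentiableAt ℝ h x)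
    (hne : ∀ x ∈ s, ℓ ∘L fderiv ℝ h x ≠ 0) : μ s = 0 := by
  rcases s.eq_empty_or_nonempty with rfl | ⟨x₀, hx₀⟩
  · simp
  obtain ⟨v, hv⟩ : ∃ v : X, v ≠ 0 := by
    obtain ⟨v, hv⟩ := DFunLike.ne_iff.1 (hne x₀ hx₀)
    exact ⟨v, fun h ↦ hv (by simp [h])⟩
  -- Multiplying by `v` gives a self-map of `X`. It is zero on `s`, so the linear map 0 approximates
  -- it with constant 0, which forces its derivative to vanish almost everywhere on `s`.
  have happ : ApproximatesLinearOn (fun x ↦ ℓ (h x) • v) (0 : X →L[ℝ] X) s 0 := by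
    intro x hx y hy
    simp [hz x hx, hz y hy]
  have hae := happ.norm_fderiv_sub_le μ hs (fun x ↦ (ℓ ∘L fderiv ℝ h x).smulRight v) fun x hx ↦
    ((ℓ.hasFDerivAt.comp x (hd x hx).hasFDerivAt).smul_const v).hasFDerivWithinAt
  rw [ae_restrict_iff' hs] at hae
  refine measure_mono_null (fun x hx ↦ ?_) (ae_iff.1 hae)
  rw [mem_ofPred_eq]
  intro hcon
  have h0 : ℓ ∘L fderiv ℝ h x = 0 ∨ v = 0 := by simpa using hcon hx
  exact hne x hx (h0.resolve_right hv)

/-- The image of a set of points of vanishing derivative is null, if the dimension of the target is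
at least half of the dimension of the source. -/
theorem hausdorffMeasure_image_null_of_fderiv_eq_zero {X : Type*} [NormedAddCommGroup X]
    [NormedSpace ℝ X] [FiniteDimensional ℝ X] [MeasurableSpace X] [BorelSpace X]
    {Y : Type*} [NormedAddCommGroup Y] [NormedSpace ℝ Y] [MeasurableSpace Y] [BorelSpace Y]
    {g : X → Y} {Z : Set X}
    (hg : ∀ x ∈ Z, ContDiffAt ℝ 3 g x) (hZ : ∀ x ∈ Z, fderiv ℝ g x = 0)
    (hpos : 0 < finrank ℝ Y) (hdim : finrank ℝ X ≤ 2 * finrank ℝ Y) :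
    μH[(finrank ℝ Y : ℝ)] (g '' Z) = 0 := by
  have hsplit : Z = {x ∈ Z | fderiv ℝ (fderiv ℝ g) x = 0} ∪
      {x ∈ Z | fderiv ℝ (fderiv ℝ g) x ≠ 0} := by
    ext x; simp only [mem_union, mem_ofPred_eq]; tauto
  rw [hsplit, image_union, measure_union_null_iff]
  constructor
  · refine measure_image_null_of_locally_null fun a ha ↦ ?_
    obtain ⟨C, hC, δ, hδ, hb⟩ := (hg a ha.1).exists_ball_norm_sub_le_cube
    exact ⟨Metric.ball a δ, Metric.ball_mem_nhds a hδ,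
      hausdorffMeasure_image_null_of_norm_sub_le_pow hC (m := 3) (by norm_num)
        (fun x hx y hy ↦ hb x hx.2 (hZ x hx.1.1) hx.1.2 y hy.2)
        (hausdorffMeasure_eq_zero_of_finrank_lt (by omega) _)⟩
  · refine measure_image_null_of_locally_null fun a ha ↦ ?_
    have hga := hg a ha.1
    have hg' : ContDiffAt ℝ 2 (fderiv ℝ g) a := hga.fderiv_right (by norm_num)
    have hg'' : ContDiffAt ℝ 1 (fderiv ℝ (fderiv ℝ g)) a := hg'.fderiv_right (by norm_num)
    obtain ⟨C, hC, δ, hδ, hb⟩ := (hga.of_le (m := 2) (by norm_num)).exists_ball_norm_sub_le_sq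
    obtain ⟨w, hw⟩ := DFunLike.ne_iff.1 ha.2
    -- A norming functional turns D²g ≠ 0 at `a` into a scalar condition that persists nearby.
    obtain ⟨ℓ, -, hℓ⟩ := exists_dual_vector ℝ (fderiv ℝ (fderiv ℝ g) a w) (by simpa using hw)
    have hcont : ContinuousAt (fun z ↦ ℓ (fderiv ℝ (fderiv ℝ g) z w)) a :=
      ℓ.continuous.continuousAt.comp (hg''.continuousAt.clm_apply continuousAt_const)
    have hne : ∀ᶠ z in 𝓝 a, ℓ (fderiv ℝ (fderiv ℝ g) z w) ≠ 0 :=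
      hcont.eventually_ne (by rw [hℓ]; simpa using hw)
    obtain ⟨ε, hε, hball⟩ := Metric.eventually_nhds_iff_ball.1
      (hne.and (hg'.eventually (by simp)))
    refine ⟨Metric.ball a (min δ (ε / 2)), Metric.ball_mem_nhds a (by positivity), ?_⟩
    refine hausdorffMeasure_image_null_of_norm_sub_le_pow hC (m := 2) (by norm_num)
        (fun x hx y hy ↦ hb x (Metric.ball_subset_ball (min_le_left _ _) hx.2) (hZ x hx.1.1) y
          (Metric.ball_subset_ball (min_le_left _ _) hy.2)) ?_
    rcases hdim.lt_or_eq with hlt | heq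
    · exact hausdorffMeasure_eq_zero_of_finrank_lt hlt _
    rw [← heq]
    have hsub : Metric.closedBall a (ε / 2) ⊆ Metric.ball a ε :=
      Metric.closedBall_subset_ball (by linarith)
    -- Enlarged to a closed set, for measurability.
    refine measure_mono_null (t := Metric.closedBall a (ε / 2) ∩ fderiv ℝ g ⁻¹' {0})
      (fun x hx ↦ ⟨Metric.ball_subset_closedBall
        (Metric.ball_subset_ball (min_le_right _ _) hx.2), hZ x hx.1.1⟩) ?_
    refine measure_null_of_eq_zero_of_fderiv_ne_zero _ (h := fderiv ℝ g) ?_ (fun x hx ↦ hx.2) ℓ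
      (fun x hx ↦ (hball x (hsub hx.1)).2.differentiableAt (by simp))
      (fun x hx h0 ↦ (hball x (hsub hx.1)).1 (by
        simpa using congrArg (fun T : X →L[ℝ] ℝ ↦ T w) h0))
    exact (ContinuousOn.preimage_isClosed_of_isClosed
      (fun x hx ↦ (hball x (hsub hx)).2.continuousAt.continuousWithinAt)
      Metric.isClosed_closedBall isClosed_singleton).measurableSet

end Null

/-! ### Sard's theorem at points of low rank -/

section ConstantRank

/-- Fubini's theorem for the image of a set of vertical critical points under a fibred map. -/
theorem hausdorffMeasure_image_graph_null
    {R : Type*} [NormedAddCommGroup R] [NormedSpace ℝ R] [FiniteDimensional ℝ R]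
    {N : Type*} [NormedAddCommGroup N] [NormedSpace ℝ N] [FiniteDimensional ℝ N]
    {Q : Type*} [NormedAddCommGroup Q] [NormedSpace ℝ Q] [FiniteDimensional ℝ Q]
    [MeasurableSpace R] [BorelSpace R] [MeasurableSpace Q] [BorelSpace Q]
    {G : R × N → Q} {C : Set (R × N)} (hC : IsCompact C)
    (hG : ∀ z ∈ C, ContDiffAt ℝ 3 G z) (hv : ∀ z ∈ C, ∀ b : N, fderiv ℝ G z (0, b) = 0)
    (hpos : 0 < finrank ℝ Q) (hdim : finrank ℝ N ≤ 2 * finrank ℝ Q) :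
    μH[(finrank ℝ (R × Q) : ℝ)] ((fun z : R × N ↦ (z.1, G z)) '' C) = 0 := by
  borelize N
  -- Compactness makes the image measurable, as Fubini requires.
  have hcomp : IsCompact ((fun z : R × N ↦ (z.1, G z)) '' C) :=
    hC.image_of_continuousOn (continuousOn_fst.prodMk
      fun z hz ↦ (hG z hz).continuousAt.continuousWithinAt)
  refine absolutelyContinuous_isAddHaarMeasure (μH[(finrank ℝ (R × Q) : ℝ)] : Measure (R × Q))
    ((μH[(finrank ℝ R : ℝ)] : Measure R).prod (μH[(finrank ℝ Q : ℝ)] : Measure Q)) ?_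
  rw [measure_prod_null hcomp.measurableSet]
  refine Eventually.of_forall fun u ↦ ?_
  have hslice : Prod.mk u ⁻¹' ((fun z : R × N ↦ (z.1, G z)) '' C) =
      (fun v ↦ G (u, v)) '' {v | (u, v) ∈ C} := by
    ext q
    constructor
    · rintro ⟨⟨u', v⟩, hz, h⟩
      obtain ⟨rfl, rfl⟩ := Prod.mk.inj h
      exact ⟨v, hz, rfl⟩
    · rintro ⟨v, hz, rfl⟩
      exact ⟨(u, v), hz, rfl⟩
  simp only [hslice, Pi.zero_apply]
  have hmk (v : N) : HasFDerivAt (fun v : N ↦ (u, v)) (ContinuousLinearMap.inr ℝ R N) v :=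
    hasFDerivAt_prodMk_right u v
  refine hausdorffMeasure_image_null_of_fderiv_eq_zero (fun v hz ↦ ?_) (fun v hz ↦ ?_) hpos hdim
  · exact (hG (u, v) hz).comp v (contDiffAt_const.prodMk contDiffAt_id)
  · have := ((hG (u, v) hz).differentiableAt (by simp)).hasFDerivAt.comp v (hmk v)
    rw [show (fun v ↦ G (u, v)) = G ∘ fun v ↦ (u, v) from rfl, this.fderiv]
    ext b
    simpa using hv _ hz b

/-- A linear map over the first factor whose rank does not exceed the dimension of that factor
vanishes on the second factor. -/
theorem LinearMap.apply_inr_eq_zero_of_finrank_range_le {K R N V : Type*} [Field K]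
    [AddCommGroup R] [Module K R] [AddCommGroup N] [Module K N] [AddCommGroup V] [Module K V]
    [FiniteDimensional K R] [FiniteDimensional K N]
    (T : R × N →ₗ[K] V) (p : V →ₗ[K] R) (hp : ∀ z, p (T z) = z.1)
    (hT : finrank K (LinearMap.range T) ≤ finrank K R) (b : N) : T (0, b) = 0 := by
  let q : LinearMap.range T →ₗ[K] R := p ∘ₗ (LinearMap.range T).subtype
  have hq : Function.Surjective q := fun a ↦ ⟨⟨T (a, 0), LinearMap.mem_range_self _ _⟩, hp _⟩
  have hfr : finrank K (LinearMap.range T) = finrank K R :=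
    hT.antisymm (LinearMap.finrank_le_finrank_of_surjective hq)
  have hinj : Function.Injective q :=
    (LinearMap.injective_iff_surjective_of_finrank_eq_finrank hfr).2 hq
  have : (⟨T (0, b), LinearMap.mem_range_self _ _⟩ : LinearMap.range T) = 0 :=
    hinj (by rw [map_zero]; exact hp _)
  simpa using congrArg Subtype.val this

variable {X : Type*} [NormedAddCommGroup X] [NormedSpace ℝ X] [FiniteDimensional ℝ X]
  {Y : Type*} [NormedAddCommGroup Y] [NormedSpace ℝ Y] [FiniteDimensional ℝ Y]
  [MeasurableSpace Y] [BorelSpace Y]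

/-- With r the rank at `a`, straightening leaves fibres of dimension dim X - r mapping to dimension
dim Y - r, so `hdim` is exactly the factor-two condition on the fibres. -/
theorem exists_nhds_hausdorffMeasure_image_null {f : X → Y} {a : X} (hf : ContDiffAt ℝ 3 f a)
    (hlt : finrank ℝ (LinearMap.range (fderiv ℝ f a).toLinearMap) < finrank ℝ Y)
    (hdim : finrank ℝ X + finrank ℝ (LinearMap.range (fderiv ℝ f a).toLinearMap)
      ≤ 2 * finrank ℝ Y) :
    ∃ V ∈ 𝓝 a, μH[(finrank ℝ Y : ℝ)] (f '' ({x | finrank ℝ (LinearMap.range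
      (fderiv ℝ f x).toLinearMap) ≤ finrank ℝ (LinearMap.range (fderiv ℝ f a).toLinearMap)} ∩ V))
      = 0 := by
  set A := fderiv ℝ f a with hA
  set R := LinearMap.range A.toLinearMap with hR
  set N := LinearMap.ker A.toLinearMap with hN
  obtain ⟨Q, hRQ⟩ := R.exists_isCompl
  let eY : (R × Q) ≃L[ℝ] Y := (R.prodEquivOfIsCompl Q hRQ).toContinuousLinearEquiv
  let PR : Y →L[ℝ] R := (ContinuousLinearMap.fst ℝ R Q) ∘L (eY.symm : Y →L[ℝ] R × Q)
  let PQ : Y →L[ℝ] Q := (ContinuousLinearMap.snd ℝ R Q) ∘L (eY.symm : Y →L[ℝ] R × Q)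
  have heY (y : Y) : eY (PR y, PQ y) = y := eY.apply_symm_apply y
  have hPR (y : Y) (hy : y ∈ R) (h0 : PR y = 0) : y = 0 := by
    have : eY (⟨y, hy⟩, 0) = y := by simp [eY]
    have h2 : PR y = ⟨y, hy⟩ := by
      conv_lhs => rw [← this]
      simp [PR]
    rw [h0] at h2
    exact (congrArg Subtype.val h2).symm
  obtain ⟨pN, hpN⟩ := N.subtype.exists_leftInverse_of_injective N.ker_subtype
  let PN : X →L[ℝ] N := pN.toContinuousLinearMap
  have hPN (x : X) (hx : x ∈ N) : PN x = ⟨x, hx⟩ := LinearMap.congr_fun hpN ⟨x, hx⟩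
  -- A local diffeomorphism at `a`: `PR` is injective on the range of `A`, and `PN` is the identity
  -- on its kernel.
  let Φ : X → R × N := fun x ↦ (PR (f x), PN x)
  have hΦ : ContDiffAt ℝ 3 Φ a := (PR.contDiff.contDiffAt.comp a hf).prodMk PN.contDiff.contDiffAt
  let D : X →L[ℝ] R × N := (PR ∘L A).prod PN
  have hD : HasFDerivAt Φ D a :=
    (PR.hasFDerivAt.comp a (hf.differentiableAt (by simp)).hasFDerivAt).prodMk PN.hasFDerivAt
  have hDinj : Function.Injective D := by
    rw [injective_iff_map_eq_zero]
    intro x hx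
    have h1 : PR (A x) = 0 := congrArg Prod.fst hx
    have h2 : PN x = 0 := congrArg Prod.snd hx
    have hxN : x ∈ N := hPR _ (LinearMap.mem_range_self A.toLinearMap x) h1
    rw [hPN x hxN] at h2
    exact congrArg Subtype.val h2
  have hfin : finrank ℝ X = finrank ℝ (R × N) := by
    rw [finrank_prod]; exact (LinearMap.finrank_range_add_finrank_ker A.toLinearMap).symm
  let D' : X ≃L[ℝ] R × N :=
    (LinearEquiv.ofInjectiveOfFinrankEq D.toLinearMap hDinj hfin).toContinuousLinearEquiv
  have hD' : HasFDerivAt Φ (D' : X →L[ℝ] R × N) a := hD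
  have hst : HasStrictFDerivAt Φ (D' : X →L[ℝ] R × N) a :=
    hΦ.hasStrictFDerivAt' hD' (by simp)
  obtain ⟨Ψ, hΨa, hΨ, hleft, hright⟩ : ∃ Ψ : R × N → X, Ψ (Φ a) = a ∧ ContDiffAt ℝ 3 Ψ (Φ a) ∧
      (∀ᶠ x in 𝓝 a, Ψ (Φ x) = x) ∧ (∀ᶠ z in 𝓝 (Φ a), Φ (Ψ z) = z) :=
    ⟨hst.localInverse Φ D' a, hst.localInverse_apply_image, hΦ.to_localInverse hD' (by simp),
      hst.eventually_left_inverse, hst.eventually_right_inverse⟩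
  have hfΨ : ContDiffAt ℝ 3 (f ∘ Ψ) (Φ a) := ContDiffAt.comp _ (by rwa [hΨa]) hΨ
  let G : R × N → Q := fun z ↦ PQ (f (Ψ z))
  have hG : ContDiffAt ℝ 3 G (Φ a) := PQ.contDiff.contDiffAt.comp _ hfΨ
  have hfev : ∀ᶠ z in 𝓝 (Φ a), ContDiffAt ℝ 3 f (Ψ z) := by
    have := hf.eventually (by simp)
    rw [← hΨa] at this
    exact hΨ.continuousAt.eventually this
  have hgood : ∀ᶠ z in 𝓝 (Φ a), ContDiffAt ℝ 3 G z ∧ ContDiffAt ℝ 3 Ψ z ∧ ContDiffAt ℝ 3 f (Ψ z) ∧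
      ∀ᶠ w in 𝓝 z, Φ (Ψ w) = w :=
    (hG.eventually (by simp)).and ((hΨ.eventually (by simp)).and (hfev.and
      hright.eventually_nhds))
  obtain ⟨ε, hε, hball⟩ := Metric.nhds_basis_closedBall.eventually_iff.1 hgood
  let C : Set (R × N) := Metric.closedBall (Φ a) ε ∩
    (fun z ↦ (fderiv ℝ G z) ∘L ContinuousLinearMap.inr ℝ R N) ⁻¹' {0}
  have hC : IsCompact C := by
    refine (isCompact_closedBall _ _).of_isClosed_subset ?_ inter_subset_left
    refine ContinuousOn.preimage_isClosed_of_isClosed (fun z hz ↦ ?_)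
      Metric.isClosed_closedBall isClosed_singleton
    exact (((hball hz).1.fderiv_right (m := 2) (by norm_num)).continuousAt.clm_comp
      continuousAt_const).continuousWithinAt
  have hnull := hausdorffMeasure_image_graph_null hC (fun z hz ↦ (hball hz.1).1)
    (fun z hz b ↦ by simpa using congrArg (fun T : N →L[ℝ] Q ↦ T b) hz.2)
    (by have := Submodule.finrank_add_eq_of_isCompl hRQ; omega)
    (by
      have := Submodule.finrank_add_eq_of_isCompl hRQ
      have : finrank ℝ R + finrank ℝ N = finrank ℝ X :=
        LinearMap.finrank_range_add_finrank_ker A.toLinearMap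
      omega)
  refine ⟨{x | Ψ (Φ x) = x} ∩ Φ ⁻¹' Metric.closedBall (Φ a) ε,
    inter_mem hleft (hΦ.continuousAt.preimage_mem_nhds (Metric.closedBall_mem_nhds _ hε)), ?_⟩
  have himage := eY.lipschitz.hausdorffMeasure_image_le (d := (finrank ℝ Y : ℝ)) (by positivity)
    ((fun z : R × N ↦ (z.1, G z)) '' C)
  rw [eY.toLinearEquiv.finrank_eq] at hnull
  rw [hnull, mul_zero] at himage
  refine measure_mono_null ?_ (le_antisymm himage zero_le)
  rintro _ ⟨x, ⟨hxr, hxΨ, hxB⟩, rfl⟩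
  have hxr : finrank ℝ (LinearMap.range (fderiv ℝ f x).toLinearMap) ≤ finrank ℝ R := hxr
  have hxΨ : Ψ (Φ x) = x := hxΨ
  refine ⟨(PR (f x), PQ (f x)), ⟨Φ x, ⟨hxB, ?_⟩, by simp [Φ, G, hxΨ]⟩, heY _⟩
  obtain ⟨-, hΨx, hfx, hr⟩ := hball hxB
  have hT : HasFDerivAt (f ∘ Ψ) (fderiv ℝ f x ∘L fderiv ℝ Ψ (Φ x)) (Φ x) := by
    have h := (hfx.differentiableAt (by simp)).hasFDerivAt
    rw [hxΨ] at h
    refine HasFDerivAt.comp _ ?_ (hΨx.differentiableAt (by simp)).hasFDerivAt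
    rwa [hxΨ]
  set T := fderiv ℝ f x ∘L fderiv ℝ Ψ (Φ x) with hTdef
  -- Since Φ ∘ Ψ = id near `Φ x`, the `R`-part of f ∘ Ψ is the first projection. Thus `T` already
  -- has rank dim R from `R`, leaving none for `N`.
  have hTR : ∀ z, PR (T z) = z.1 := by
    have h1 : HasFDerivAt (fun w ↦ PR (f (Ψ w))) (PR ∘L T) (Φ x) := PR.hasFDerivAt.comp _ hT
    have h2 : HasFDerivAt (fun w ↦ PR (f (Ψ w))) (ContinuousLinearMap.fst ℝ R N) (Φ x) :=
      hasFDerivAt_fst.congr_of_eventuallyEq (hr.mono fun w hw ↦ congrArg Prod.fst hw)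
    exact fun z ↦ congrArg (fun L : R × N →L[ℝ] R ↦ L z) (h1.unique h2)
  have hrank : finrank ℝ (LinearMap.range T.toLinearMap) ≤ finrank ℝ R := by
    refine (Submodule.finrank_mono ?_).trans hxr
    exact LinearMap.range_comp_le_range (fderiv ℝ Ψ (Φ x)).toLinearMap (fderiv ℝ f x).toLinearMap
  have hGT : fderiv ℝ G (Φ x) = PQ ∘L T := (PQ.hasFDerivAt.comp _ hT).fderiv
  change fderiv ℝ G (Φ x) ∘L ContinuousLinearMap.inr ℝ R N = 0
  ext b
  have hb := T.toLinearMap.apply_inr_eq_zero_of_finrank_range_le PR.toLinearMap hTR hrank b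
  have hb : T (0, b) = 0 := hb
  simp [hGT, hb]

/-- **Sard's theorem** for points of low rank: the image of a set of points at which the rank of the
derivative is at most `r` is null, where `r` is smaller than the dimension of the target and
`dim X + r ≤ 2 dim Y`. -/
theorem hausdorffMeasure_image_null_of_finrank_range_le {f : X → Y} {K : Set X}
    (hf : ∀ x ∈ K, ContDiffAt ℝ 3 f x) {r : ℕ}
    (hK : ∀ x ∈ K, finrank ℝ (LinearMap.range (fderiv ℝ f x).toLinearMap) ≤ r)
    (hlt : r < finrank ℝ Y) (hdim : finrank ℝ X + r ≤ 2 * finrank ℝ Y) :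
    μH[(finrank ℝ Y : ℝ)] (f '' K) = 0 := by
  -- The local lemma controls only points whose rank is at most that at the centre, hence the
  -- stratification by exact rank.
  have hcov : f '' K ⊆ ⋃ k : ℕ, f '' {x ∈ K | finrank ℝ (LinearMap.range
      (fderiv ℝ f x).toLinearMap) = k} := by
    rintro _ ⟨x, hx, rfl⟩
    exact mem_iUnion.2 ⟨_, x, ⟨hx, rfl⟩, rfl⟩
  refine measure_mono_null hcov (measure_iUnion_null fun k ↦ ?_)
  refine measure_image_null_of_locally_null fun a ha ↦ ?_
  have har := hK a ha.1
  obtain ⟨V, hV, hnull⟩ := exists_nhds_hausdorffMeasure_image_null (hf a ha.1)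
    (har.trans_lt hlt) (by omega)
  refine ⟨V, hV, measure_mono_null (image_mono (inter_subset_inter_left V fun x hx ↦ ?_)) hnull⟩
  exact (hx.2.trans ha.2.symm).le

end ConstantRank

/-! ### Rank of a Poisson morphism over zeros of π -/

section PoissonRank

/-- If `D ∘ B ∘ D* = 0` with `B` injective, then the rank of `D` is at most half of the dimension
of its source. -/
theorem LinearMap.two_mul_finrank_range_le_of_dual_sandwich {K V W : Type*} [Field K]
    [AddCommGroup V] [Module K V] [AddCommGroup W] [Module K W] [FiniteDimensional K V]
    (D : V →ₗ[K] W) (B : Dual K V →ₗ[K] V) (hB : Function.Injective B)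
    (h : ∀ α β : Dual K W, β (D (B (α ∘ₗ D))) = 0) :
    2 * finrank K (LinearMap.range D) ≤ finrank K V := by
  -- The left side has dimension rank D and the right side dim V - rank D.
  have hle : (LinearMap.range D.dualMap).map B ≤ LinearMap.ker D := by
    rintro _ ⟨_, ⟨α, rfl⟩, rfl⟩
    exact (forall_dual_apply_eq_zero_iff K _).1 (h α)
  have h1 := Submodule.finrank_mono hle
  rw [← ((Submodule.equivMapOfInjective B hB _).finrank_eq), LinearMap.finrank_range_dualMap_eq_finrank_range] at h1
  have h2 := D.finrank_range_add_finrank_ker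
  omega

variable {𝕜 : Type*} [RCLike 𝕜] {E : Type*} [NormedAddCommGroup E] [NormedSpace 𝕜 E]
  {M : Type*} [TopologicalSpace M] [ChartedSpace E M]
  {F : Type*} [NormedAddCommGroup F] [NormedSpace 𝕜 F]
  {S : Type*} [TopologicalSpace S] [ChartedSpace F S]

theorem PoissonStructure.IsPoissonMorphism.two_mul_finrank_range_mfderiv_le
    [FiniteDimensional 𝕜 E] [FiniteDimensional 𝕜 F]
    {πS : PoissonStructure 𝕜 F S} {π : PoissonStructure 𝕜 E M} {φ : S → M}
    (hφ : IsPoissonMorphism πS π φ) (hS : πS.IsSymplectic)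
    {e : OpenPartialHomeomorph M E} (he : e ∈ IsManifold.maximalAtlas 𝓘(𝕜, E) ∞ M)
    {s : S} (hs : φ s ∈ e.source) (hzero : π.sharp (φ s) = 0) :
    2 * finrank 𝕜 (LinearMap.range (mfderiv 𝓘(𝕜, F) 𝓘(𝕜, E) (e ∘ φ) s).toLinearMap)
      ≤ finrank 𝕜 F := by
  have hemd : ContMDiffOn 𝓘(𝕜, E) 𝓘(𝕜, E) ∞ e e.source := contMDiffOn_of_mem_maximalAtlas he
  have heφ : MDifferentiableAt 𝓘(𝕜, F) 𝓘(𝕜, E) (e ∘ φ) s :=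
    ((hemd.contMDiffAt (e.open_source.mem_nhds hs)).mdifferentiableAt (by simp)).comp s
      (hφ.contMDiff.mdifferentiableAt (by simp))
  let D : F →L[𝕜] E := mfderiv 𝓘(𝕜, F) 𝓘(𝕜, E) (e ∘ φ) s
  have hdiff (α : E →L[𝕜] 𝕜) : cotangentDiff F ((α ∘ e) ∘ φ) s = α ∘L D := by
    have h := (α.hasMFDerivAt (x := (e ∘ φ) s)).comp s heφ.hasMFDerivAt
    exact h.mfderiv
  have hkey (α β : E →L[𝕜] 𝕜) : β (D (πS.sharp s (α ∘L D))) = 0 := by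
    have hα (γ : E →L[𝕜] 𝕜) : ContMDiffOn 𝓘(𝕜, E) 𝓘(𝕜, 𝕜) ∞ (γ ∘ e) e.source :=
      γ.contMDiff.comp_contMDiffOn hemd
    have h := hφ.map_bracket e.source e.open_source (α ∘ e) (β ∘ e) (hα α) (hα β) s hs
    simp only [bracket, sharpBracket, hzero, hdiff] at h
    exact h.trans (by simp)
  let toC : Dual 𝕜 F ≃ₗ[𝕜] (F →L[𝕜] 𝕜) := LinearMap.toContinuousLinearMap
  let B : Dual 𝕜 F →ₗ[𝕜] F := (πS.sharp s).toLinearMap ∘ₗ toC.toLinearMap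
  exact D.toLinearMap.two_mul_finrank_range_le_of_dual_sandwich B
    ((hS s).1.comp toC.injective)
    fun α β ↦ hkey (LinearMap.toContinuousLinearMap α) (LinearMap.toContinuousLinearMap β)

end PoissonRank

/-! ### Passage from 𝕜 to ℝ -/

section Resolution

variable {𝕜 : Type*} [RCLike 𝕜] {E : Type*} [NormedAddCommGroup E] [NormedSpace 𝕜 E]
  {F : Type*} [NormedAddCommGroup F] [NormedSpace 𝕜 F]

/-- Low rank Sard theorem for `C^∞` maps over `ℝ` or `ℂ`, with the measure on the target taken for
the underlying real vector space. -/
theorem hausdorffMeasure_image_null_of_finrank_range_le_rclike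
    [FiniteDimensional 𝕜 E] [FiniteDimensional 𝕜 F]
    [NormedSpace ℝ E] [IsScalarTower ℝ 𝕜 E] [NormedSpace ℝ F] [IsScalarTower ℝ 𝕜 F]
    [MeasurableSpace E] [BorelSpace E] {f : F → E} {K : Set F}
    (hf : ∀ x ∈ K, ContDiffAt 𝕜 3 f x) {r : ℕ}
    (hK : ∀ x ∈ K, finrank 𝕜 (LinearMap.range (fderiv 𝕜 f x).toLinearMap) ≤ r)
    (hlt : r < finrank 𝕜 E) (hdim : finrank 𝕜 F + r ≤ 2 * finrank 𝕜 E) :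
    μH[(finrank ℝ E : ℝ)] (f '' K) = 0 := by
  have : FiniteDimensional ℝ E := FiniteDimensional.trans ℝ 𝕜 E
  have : FiniteDimensional ℝ F := FiniteDimensional.trans ℝ 𝕜 F
  have hE := finrank_mul_finrank ℝ 𝕜 E
  have hF := finrank_mul_finrank ℝ 𝕜 F
  have hd : 0 < finrank ℝ 𝕜 := finrank_pos
  -- All dimensions and ranks scale by the same factor, so both inequalities survive.
  refine hausdorffMeasure_image_null_of_finrank_range_le (r := finrank ℝ 𝕜 * r)
    (fun x hx ↦ (hf x hx).restrict_scalars ℝ) (fun x hx ↦ ?_) ?_ ?_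
  · rw [((hf x hx).differentiableAt (by simp)).fderiv_restrictScalars ℝ]
    have h := finrank_mul_finrank ℝ 𝕜 (LinearMap.range (fderiv 𝕜 f x).toLinearMap)
    calc _ = finrank ℝ ((LinearMap.range (fderiv 𝕜 f x).toLinearMap).restrictScalars ℝ) := rfl
      _ = finrank ℝ 𝕜 * finrank 𝕜 (LinearMap.range (fderiv 𝕜 f x).toLinearMap) := h.symm
      _ ≤ _ := Nat.mul_le_mul_left _ (hK x hx)
  · rw [← hE]; gcongr
  · rw [← hE, ← hF]; nlinarith

end Resolution

/-! ### The contradiction on P -/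

theorem mainTheorem6 {𝕜 : Type*} [RCLike 𝕜] (n : ℕ) (hn : 4 ≤ n)
    {E : Type*} [NormedAddCommGroup E] [NormedSpace 𝕜 E] [FiniteDimensional 𝕜 E]
    (hE : Module.finrank 𝕜 E = n)
    {M : Type*} [TopologicalSpace M] [T2Space M] [ChartedSpace E M] [IsManifold 𝓘(𝕜, E) ∞ M]
    (π : PoissonStructure 𝕜 E M)
    (P : Set M) (hP : IsSubmanifoldOfCodim 𝕜 E 1 P) (hPne : P.Nonempty)
    (hsing : P ⊆ π.singularLocus)
    {F : Type*} [NormedAddCommGroup F] [NormedSpace 𝕜 F] [FiniteDimensional 𝕜 F]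
    {S : Type*} [TopologicalSpace S] [T2Space S] [SecondCountableTopology S]
    [ChartedSpace F S] [IsManifold 𝓘(𝕜, F) ∞ S]
    (πS : PoissonStructure 𝕜 F S) (φ : S → M)
    (hres : PoissonStructure.IsSymplecticResolution πS π φ) :
    ¬ ∀ p ∈ P, π.sharp p = 0 := by
  intro hzero
  obtain ⟨p, hp⟩ := hPne
  obtain ⟨e, he, hpe, W, hW, hPW⟩ := hP p hp
  let _ : NormedSpace ℝ E := NormedSpace.restrictScalars ℝ 𝕜 E
  have : IsScalarTower ℝ 𝕜 E := RestrictScalars.isScalarTower ℝ 𝕜 E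
  let _ : NormedSpace ℝ F := NormedSpace.restrictScalars ℝ 𝕜 F
  have : IsScalarTower ℝ 𝕜 F := RestrictScalars.isScalarTower ℝ 𝕜 F
  let _ : NormedSpace ℝ W := NormedSpace.restrictScalars ℝ 𝕜 W
  have : IsScalarTower ℝ 𝕜 W := RestrictScalars.isScalarTower ℝ 𝕜 W
  have : FiniteDimensional ℝ W := FiniteDimensional.trans ℝ 𝕜 W
  borelize ↥W
  obtain ⟨l, hl⟩ := W.subtype.exists_leftInverse_of_injective W.ker_subtype
  -- The preimage of P need not be a manifold; composing with a projection onto `W` gives a map on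
  -- an open subset of Σ, to which Sard applies.
  let L : E →L[𝕜] W := l.toContinuousLinearMap
  have hLW (w : W) : L w = w := LinearMap.congr_fun hl w
  have hφ := hres.morphism
  have hemd : ContMDiffOn 𝓘(𝕜, E) 𝓘(𝕜, E) ∞ e e.source := contMDiffOn_of_mem_maximalAtlas he
  have heφ (s : S) (hs : φ s ∈ e.source) : ContMDiffAt 𝓘(𝕜, F) 𝓘(𝕜, E) ∞ (e ∘ φ) s :=
    (hemd.contMDiffAt (e.open_source.mem_nhds hs)).comp s hφ.contMDiff.contMDiffAt
  set A : Set S := φ ⁻¹' (P ∩ e.source) with hA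
  have hnull : μH[(finrank ℝ W : ℝ)] ((fun s ↦ L (e (φ s))) '' A) = 0 := by
    refine measure_image_null_of_locally_null fun s _ ↦
      ⟨(chartAt F s).source, chart_source_mem_nhds F s, ?_⟩
    set c := chartAt F s with hc
    have himage : (fun s ↦ L (e (φ s))) '' (A ∩ c.source) ⊆
        (L ∘ ((e ∘ φ) ∘ c.symm)) '' (c.target ∩ c.symm ⁻¹' A) := by
      rintro _ ⟨x, hx, rfl⟩
      refine ⟨c x, ⟨c.map_source hx.2, ?_⟩, ?_⟩
      · rw [mem_preimage, c.left_inv hx.2]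
        exact hx.1
      · simp [c.left_inv hx.2]
    have hfin := hres.finrank_eq
    have hcs : ∀ y ∈ c.target, ContMDiffAt 𝓘(𝕜, F) 𝓘(𝕜, F) ∞ c.symm y := fun y hy ↦
      contMDiffOn_chart_symm.contMDiffAt (c.open_target.mem_nhds hy)
    have hsmooth : ∀ y ∈ c.target ∩ c.symm ⁻¹' A, ContDiffAt 𝕜 3 ((e ∘ φ) ∘ c.symm) y := by
      intro y hy
      have h : ContMDiffAt 𝓘(𝕜, F) 𝓘(𝕜, E) ∞ ((e ∘ φ) ∘ c.symm) y :=
        (heφ (c.symm y) hy.2.2).comp y (hcs y hy.1)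
      exact contDiffAt_infty.1 h.contDiffAt 3
    -- With dim W = n - 1, this needs n/2 < n - 1 and n + n/2 ≤ 2(n - 1). The latter is an equality
    -- for n = 4, so the borderline case of the critical-set lemma does occur.
    refine measure_mono_null himage (hausdorffMeasure_image_null_of_finrank_range_le_rclike
      (𝕜 := 𝕜) (r := n / 2) ?_ ?_ (by omega) (by omega))
    · exact fun y hy ↦ L.contDiff.contDiffAt.comp _ (hsmooth y hy)
    · intro y hy
      have hcomp : fderiv 𝕜 (L ∘ ((e ∘ φ) ∘ c.symm)) y = L ∘L fderiv 𝕜 ((e ∘ φ) ∘ c.symm) y :=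
        (L.hasFDerivAt.comp _ ((hsmooth y hy).differentiableAt (by simp)).hasFDerivAt).fderiv
      obtain ⟨D, D', hD, hDD'⟩ : ∃ (D : F →L[𝕜] E) (D' : F →L[𝕜] F),
          2 * finrank 𝕜 (LinearMap.range D.toLinearMap) ≤ finrank 𝕜 F ∧
          fderiv 𝕜 ((e ∘ φ) ∘ c.symm) y = D ∘L D' := by
        refine ⟨mfderiv 𝓘(𝕜, F) 𝓘(𝕜, E) (e ∘ φ) (c.symm y), mfderiv 𝓘(𝕜, F) 𝓘(𝕜, F) c.symm y,
          hφ.two_mul_finrank_range_mfderiv_le hres.symplectic he hy.2.2 (hzero _ hy.2.1), ?_⟩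
        rw [← mfderiv_eq_fderiv]
        exact mfderiv_comp y ((heφ (c.symm y) hy.2.2).mdifferentiableAt (by simp))
          ((hcs y hy.1).mdifferentiableAt (by simp))
      have h₁ : finrank 𝕜 (LinearMap.range (L ∘L (D ∘L D')).toLinearMap) ≤
          finrank 𝕜 (LinearMap.range (D ∘L D').toLinearMap) := by
        rw [ContinuousLinearMap.toLinearMap_comp, LinearMap.range_comp]
        exact Submodule.finrank_map_le _ _
      have h₂ : finrank 𝕜 (LinearMap.range (D ∘L D').toLinearMap) ≤
          finrank 𝕜 (LinearMap.range D.toLinearMap) := by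
        rw [ContinuousLinearMap.toLinearMap_comp]
        exact Submodule.finrank_mono (LinearMap.range_comp_le_range _ _)
      rw [hcomp, hDD']
      omega
  have hopen : IsOpen ((↑) ⁻¹' e.target : Set W) := e.open_target.preimage continuous_subtype_val
  -- Surjectivity of φ: every point of P in the chart lifts to Σ, and `L` fixes its coordinates.
  have hsub : ((↑) ⁻¹' e.target : Set W) ⊆ (fun s ↦ L (e (φ s))) '' A := by
    intro w hw
    have hw : (w : E) ∈ e.target := hw
    obtain ⟨s, hs⟩ := hres.surjective (e.symm w)
    have hes : e.symm w ∈ e.source := e.map_target hw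
    refine ⟨s, ?_, ?_⟩
    · rw [hA, mem_preimage, hs]
      exact ⟨(hPW _ hes).2 (by rw [e.right_inv hw]; exact w.2), hes⟩
    · simp only [hs, e.right_inv hw, hLW]
  have hne : ((↑) ⁻¹' e.target : Set W).Nonempty :=
    ⟨⟨e p, (hPW p hpe).1 hp⟩, e.map_source hpe⟩
  exact (hopen.measure_pos (μH[(finrank ℝ W : ℝ)]) hne).ne' (measure_mono_null hsub hnull)
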